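/- Let $q\ge 1$ and $r\ge 0$ be integers and let $M,N$ be real symmetric $(q+r)\times(q+r)$ matrices, partitioned as $M=\begin{bmatrix}M_{11}&M_{12}\\M_{21}&M_{22}\end{bmatrix}$ with $M_{11}$ of size $q\times q$ and $M_{22}$ of size $r\times r$. Write $\succeq$, $\succ$ for positive semidefiniteness and positive definiteness of symmetric matrices, and let $$\mathcal Z_{q,r}(N)=\left\{Z\in\mathbb R^{r\times q}\ \middle|\ \begin{bmatrix}I_q\\Z\end{bmatrix}^\top N\begin{bmatrix}I_q\\Z\end{bmatrix}\succeq 0\right\}.$$ Assume that $\mathcal Z_{q,r}(N)$ is nonempty, that $M_{22}\preceq 0$, and that $\ker M_{22}\subseteq\ker M_{12}$. Then the implication $$\begin{bmatrix}I_q\\Z\end{bmatrix}^\top N\begin{bmatrix}I_q\\Z\end{bmatrix}\succeq 0\ \Longrightarrow\ \begin{bmatrix}I_q\\Z\end{bmatrix}^\top M\begin{bmatrix}I_q\\Z\end{bmatrix}\succ 0$$ holds for all $Z\in\mathbb R^{r\times q}$ if and only if there exist scalars $\alpha\ge 0$ and $\beta>0$ such that $$M-\alpha N\succeq\begin{bmatrix}\beta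 I_q&0\\0&0\end{bmatrix}.$$ -/

import Mathlib

namespace QMI

open Matrix

/-- The value `[I; Z]ᵀ N [I; Z]` of the quadratic matrix function given by `N` at the
`r × q` matrix `Z`; here `[I; Z]` is the `(q + r) × q` matrix with `I` stacked on top of `Z`. -/
def quadForm {q r : ℕ} (N : Matrix (Fin q ⊕ Fin r) (Fin q ⊕ Fin r) ℝ)
    (Z : Matrix (Fin r) (Fin q) ℝ) : Matrix (Fin q) (Fin q) ℝ :=
  (fromRows (1 : Matrix (Fin q) (Fin q) ℝ) Z)ᵀ * N *
    fromRows (1 : Matrix (Fin q) (Fin q) ℝ) Z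

/-- The solution set of the quadratic matrix inequality `[I; Z]ᵀ N [I; Z] ⪰ 0`. -/
def solSet {q r : ℕ} (N : Matrix (Fin q ⊕ Fin r) (Fin q ⊕ Fin r) ℝ) :
    Set (Matrix (Fin r) (Fin q) ℝ) :=
  {Z | (quadForm N Z).PosSemidef}

end QMI

/-! Sufficiency is a compression by `[I; Z]`. For necessity, read the matrices as quadratic forms in
`(x, y)`. Rank-one perturbations of a solution along `w` with `wᵀ N₂₂ w ≥ 0` give unbounded families
of solutions; since `M₂₂ ⪯ 0`, positivity of `M` along them forces `M₂₂ w = 0`. If `N₂₂` has a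
positive direction, or `ker N₂₂ ⊄ ker N₁₂`, this freedom kills `M₂₂`, hence `M₁₂`, and `α = 0`
works. Otherwise `N₂₂ ⪯ 0` and squares can be completed around some `Zc`. By Cauchy–Schwarz, each
`(x, y)` with `x ≠ 0` and nonnegative `N`-value is, modulo `ker N₂₂`, of the form `(x, Z x)` for a
solution `Z` (`pos_of_nonneg`). The matrix implication thus becomes one about vectors, and the
strict S-lemma applies on a complement of `ker N₂₂`, a kernel along which neither form varies. -/

namespace QMI

open Matrix

/-! ### The S-lemma on a subspace -/

section SLemma

variable {n : Type*} [Fintype n]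

theorem dotProduct_mulVec_comm_of_isSymm {A : Matrix n n ℝ} (hA : A.IsSymm) (u v : n → ℝ) :
    u ⬝ᵥ A *ᵥ v = v ⬝ᵥ A *ᵥ u := by
  rw [dotProduct_mulVec, ← mulVec_transpose, hA.eq, dotProduct_comm]

theorem dotProduct_mulVec_add_smul {A : Matrix n n ℝ} (hA : A.IsSymm) (u v : n → ℝ) (t : ℝ) :
    (u + t • v) ⬝ᵥ A *ᵥ (u + t • v) =
      u ⬝ᵥ A *ᵥ u + 2 * t * (u ⬝ᵥ A *ᵥ v) + t ^ 2 * (v ⬝ᵥ A *ᵥ v) := by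
  simp only [mulVec_add, mulVec_smul, dotProduct_add, add_dotProduct, dotProduct_smul,
    smul_dotProduct, smul_eq_mul, dotProduct_mulVec_comm_of_isSymm hA v u]
  ring

theorem dotProduct_mulVec_smul_self (A : Matrix n n ℝ) (v : n → ℝ) (t : ℝ) :
    (t • v) ⬝ᵥ A *ᵥ (t • v) = t ^ 2 * (v ⬝ᵥ A *ᵥ v) := by
  simp only [mulVec_smul, dotProduct_smul, smul_dotProduct, smul_eq_mul]
  ring

/-- The two-dimensional core of the S-lemma: on the plane spanned by `u` and `v`, the quadratic
form of `N` vanishes along two lines, and combining the values of `M` there gives the claim. -/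
theorem mul_le_mul_of_nonneg_imp_nonneg {S : Submodule ℝ (n → ℝ)} {M N : Matrix n n ℝ}
    (hM : M.IsSymm) (hN : N.IsSymm)
    (h : ∀ v ∈ S, 0 ≤ v ⬝ᵥ N *ᵥ v → 0 ≤ v ⬝ᵥ M *ᵥ v)
    {u v : n → ℝ} (hu : u ∈ S) (hv : v ∈ S)
    (hNu : u ⬝ᵥ N *ᵥ u < 0) (hNv : 0 < v ⬝ᵥ N *ᵥ v) :
    (u ⬝ᵥ N *ᵥ u) * (v ⬝ᵥ M *ᵥ v) ≤ (u ⬝ᵥ M *ᵥ u) * (v ⬝ᵥ N *ᵥ v) := by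
  have key : ∀ t : ℝ, u ⬝ᵥ N *ᵥ u + 2 * t * (u ⬝ᵥ N *ᵥ v) + t ^ 2 * (v ⬝ᵥ N *ᵥ v) = 0 →
      0 ≤ u ⬝ᵥ M *ᵥ u + 2 * t * (u ⬝ᵥ M *ᵥ v) + t ^ 2 * (v ⬝ᵥ M *ᵥ v) := by
    intro t ht
    rw [← dotProduct_mulVec_add_smul hM]
    exact h _ (S.add_mem hu (S.smul_mem t hv)) (by rw [dotProduct_mulVec_add_smul hN, ht])
  generalize u ⬝ᵥ N *ᵥ u = c at *
  generalize v ⬝ᵥ N *ᵥ v = a at *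
  generalize u ⬝ᵥ N *ᵥ v = b at *
  generalize u ⬝ᵥ M *ᵥ u = f at *
  generalize v ⬝ᵥ M *ᵥ v = g at *
  generalize u ⬝ᵥ M *ᵥ v = e at *
  have hac : 0 < -(a * c) := by nlinarith
  have hd : 0 ≤ b ^ 2 - a * c := by nlinarith [sq_nonneg b]
  set s := √(b ^ 2 - a * c) with hs
  have hs2 : s ^ 2 = b ^ 2 - a * c := Real.sq_sqrt hd
  have hs0 : 0 < s := Real.sqrt_pos.2 (by nlinarith [sq_nonneg b])
  have hlt : |b| < s := abs_lt_of_sq_lt_sq (by nlinarith) hs0.le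
  obtain ⟨h1, h2⟩ := abs_lt.1 hlt
  have k1 := key ((-b + s) / a) (by field_simp; nlinarith)
  have k2 := key ((-b - s) / a) (by field_simp; nlinarith)
  have k1' : 0 ≤ f * a ^ 2 + 2 * (-b + s) * a * e + (-b + s) ^ 2 * g := by
    have := mul_nonneg k1 (sq_nonneg a)
    field_simp at this
    nlinarith
  have k2' : 0 ≤ f * a ^ 2 + 2 * (-b - s) * a * e + (-b - s) ^ 2 * g := by
    have := mul_nonneg k2 (sq_nonneg a)
    field_simp at this
    nlinarith
  have k3 : 0 ≤ (2 * s * a) * (f * a - c * g) := by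
    -- The weights `s + b` and `s - b` are positive and cancel the cross term `e`.
    have e1 := mul_nonneg (by linarith : 0 ≤ b + s) k1'
    have e2 := mul_nonneg (by linarith : 0 ≤ -b + s) k2'
    have hc : a * c = b ^ 2 - s ^ 2 := by linarith
    have : (2 * s * a) * (f * a - c * g) = 2 * s * (f * a ^ 2) - 2 * s * (a * c) * g := by ring
    rw [this, hc]
    nlinarith
  have := nonneg_of_mul_nonneg_right k3 (by positivity)
  linarith

/-- The S-lemma for homogeneous quadratic forms on a subspace. -/
theorem exists_mul_le_of_nonneg_imp_nonneg {S : Submodule ℝ (n → ℝ)} {M N : Matrix n n ℝ}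
    (hM : M.IsSymm) (hN : N.IsSymm)
    (h : ∀ v ∈ S, 0 ≤ v ⬝ᵥ N *ᵥ v → 0 ≤ v ⬝ᵥ M *ᵥ v)
    (hpos : ∃ v ∈ S, 0 < v ⬝ᵥ N *ᵥ v) :
    ∃ α : ℝ, 0 ≤ α ∧ ∀ v ∈ S, α * (v ⬝ᵥ N *ᵥ v) ≤ v ⬝ᵥ M *ᵥ v := by
  obtain ⟨v₀, hv₀, hv₀N⟩ := hpos
  set R : Set ℝ := {a | ∃ v ∈ S, 0 < v ⬝ᵥ N *ᵥ v ∧ a = (v ⬝ᵥ M *ᵥ v) / (v ⬝ᵥ N *ᵥ v)}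
  have hRne : R.Nonempty := ⟨_, v₀, hv₀, hv₀N, rfl⟩
  have hR0 : ∀ a ∈ R, 0 ≤ a := by
    rintro a ⟨v, hv, hvN, rfl⟩
    exact div_nonneg (h v hv hvN.le) hvN.le
  -- The infimum of the ratios `M / N` over `N > 0` is the largest multiplier valid there; the
  -- planar lemma puts every such ratio above the ratios from `N < 0`.
  refine ⟨sInf R, le_csInf hRne hR0, fun v hv => ?_⟩
  rcases lt_trichotomy (v ⬝ᵥ N *ᵥ v) 0 with hneg | hzero | hvN
  · rw [← div_le_iff_of_neg hneg]
    refine le_csInf hRne ?_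
    rintro a ⟨w, hw, hwN, rfl⟩
    rw [div_le_iff_of_neg hneg, div_mul_eq_mul_div, div_le_iff₀ hwN, mul_comm (w ⬝ᵥ M *ᵥ w)]
    exact mul_le_mul_of_nonneg_imp_nonneg hM hN h hv hw hneg hwN
  · rw [hzero, mul_zero]
    exact h v hv hzero.ge
  · rw [← le_div_iff₀ hvN]
    exact csInf_le ⟨0, hR0⟩ ⟨v, hv, hvN, rfl⟩

/-- The maximum is positive on the compact unit sphere of `S` and homogeneous of degree two. The
margin `ε` leaves room to perturb both forms. -/
theorem exists_pos_mul_dotProduct_le_max {S : Submodule ℝ (n → ℝ)} {M N : Matrix n n ℝ}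
    (h : ∀ v ∈ S, v ≠ 0 → 0 ≤ v ⬝ᵥ N *ᵥ v → 0 < v ⬝ᵥ M *ᵥ v) :
    ∃ ε : ℝ, 0 < ε ∧ ∀ v ∈ S, ε * (v ⬝ᵥ v) ≤ max (-(v ⬝ᵥ N *ᵥ v)) (v ⬝ᵥ M *ᵥ v) := by
  set K : Set (n → ℝ) := {v | v ∈ S ∧ v ⬝ᵥ v = 1}
  have hscale : ∀ v ∈ S, v ≠ 0 → (√(v ⬝ᵥ v))⁻¹ • v ∈ K := by
    intro v hv hv0
    have hpos : 0 < v ⬝ᵥ v := lt_of_le_of_ne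
      (Finset.sum_nonneg fun i _ => mul_self_nonneg (v i))
      (fun h0 => hv0 (dotProduct_self_eq_zero.1 h0.symm))
    refine ⟨S.smul_mem _ hv, ?_⟩
    simp only [dotProduct_smul, smul_dotProduct, smul_eq_mul]
    rw [← mul_assoc, ← mul_inv, Real.mul_self_sqrt hpos.le, inv_mul_cancel₀ hpos.ne']
  have hKcl : IsClosed K := by
    have h1 : IsClosed (S : Set (n → ℝ)) := S.closed_of_finiteDimensional
    exact h1.inter (isClosed_eq (by unfold dotProduct; fun_prop) continuous_const)
  have hKc : IsCompact K := by
    refine Metric.isCompact_of_isClosed_isBounded hKcl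
      ((Metric.isBounded_closedBall (x := (0 : n → ℝ)) (r := 1)).subset ?_)
    rintro v ⟨-, hv⟩
    rw [mem_closedBall_zero_iff, pi_norm_le_iff_of_nonneg zero_le_one]
    intro i
    rw [Real.norm_eq_abs, ← sq_le_one_iff_abs_le_one, ← hv, sq]
    exact Finset.single_le_sum (f := fun i => v i * v i) (fun i _ => mul_self_nonneg (v i))
      (Finset.mem_univ i)
  have hcont : Continuous fun v : n → ℝ => max (-(v ⬝ᵥ N *ᵥ v)) (v ⬝ᵥ M *ᵥ v) := by
    unfold dotProduct mulVec dotProduct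
    fun_prop
  rcases K.eq_empty_or_nonempty with hemp | hne
  · refine ⟨1, one_pos, fun v hv => ?_⟩
    by_cases hv0 : v = 0
    · simp [hv0]
    · exact absurd (hscale v hv hv0) (by simp [hemp])
  · obtain ⟨w, ⟨hwS, hw1⟩, hmin⟩ := hKc.exists_isMinOn hne hcont.continuousOn
    refine ⟨max (-(w ⬝ᵥ N *ᵥ w)) (w ⬝ᵥ M *ᵥ w), ?_, fun v hv => ?_⟩
    · have hw0 : w ≠ 0 := by
        rintro rfl
        simp at hw1
      rw [lt_max_iff]
      by_cases hN : 0 ≤ w ⬝ᵥ N *ᵥ w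
      · exact Or.inr (h w hwS hw0 hN)
      · exact Or.inl (by linarith)
    · by_cases hv0 : v = 0
      · simp [hv0]
      · have hpos : 0 < v ⬝ᵥ v := lt_of_le_of_ne
          (Finset.sum_nonneg fun i _ => mul_self_nonneg (v i))
          (fun h0 => hv0 (dotProduct_self_eq_zero.1 h0.symm))
        have := hmin (hscale v hv hv0)
        simp only [Set.mem_ofPred_eq, dotProduct_mulVec_smul_self] at this
        rw [inv_pow, Real.sq_sqrt hpos.le, ← mul_neg,
          ← mul_max_of_nonneg _ _ (inv_nonneg.2 hpos.le), inv_mul_eq_div, le_div_iff₀ hpos] at this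
        exact this

/-- The strict S-lemma for homogeneous quadratic forms on a subspace. -/
theorem exists_add_mul_le_of_nonneg_imp_pos {S : Submodule ℝ (n → ℝ)} {M N : Matrix n n ℝ}
    (hM : M.IsSymm) (hN : N.IsSymm)
    (h : ∀ v ∈ S, v ≠ 0 → 0 ≤ v ⬝ᵥ N *ᵥ v → 0 < v ⬝ᵥ M *ᵥ v)
    (hne : ∃ v ∈ S, v ≠ 0 ∧ 0 ≤ v ⬝ᵥ N *ᵥ v) :
    ∃ α β : ℝ, 0 ≤ α ∧ 0 < β ∧
      ∀ v ∈ S, β * (v ⬝ᵥ v) + α * (v ⬝ᵥ N *ᵥ v) ≤ v ⬝ᵥ M *ᵥ v := by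
  classical
  obtain ⟨ε, hε, hmax⟩ := exists_pos_mul_dotProduct_le_max h
  have hdot : ∀ v : n → ℝ, 0 ≤ v ⬝ᵥ v := fun v =>
    Finset.sum_nonneg fun i _ => mul_self_nonneg (v i)
  have hshift : ∀ (A : Matrix n n ℝ) (c : ℝ) (v : n → ℝ),
      v ⬝ᵥ (A + c • (1 : Matrix n n ℝ)) *ᵥ v = v ⬝ᵥ A *ᵥ v + c * (v ⬝ᵥ v) := by
    intro A c v
    simp [add_mulVec, smul_mulVec]
  have hsymm : ∀ (A : Matrix n n ℝ) (c : ℝ), A.IsSymm → (A + c • (1 : Matrix n n ℝ)).IsSymm :=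
    fun A c hA => hA.add (isSymm_one.smul c)
  -- Raising `N` by `ε / 2`, less than the margin, keeps the implication true with `M` lowered by
  -- `ε`, and makes the `N`-value of the given vector strictly positive.
  obtain ⟨α, hα, hle⟩ := exists_mul_le_of_nonneg_imp_nonneg (S := S)
    (hsymm M (-ε) hM) (hsymm N (ε / 2) hN) (by
      intro v hv hNv
      rw [hshift] at hNv ⊢
      by_cases hv0 : v = 0
      · simp [hv0]
      have hpos : 0 < v ⬝ᵥ v := lt_of_le_of_ne (hdot v)
        (fun h0 => hv0 (dotProduct_self_eq_zero.1 h0.symm))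
      rcases le_max_iff.1 (hmax v hv) with h1 | h1
      · nlinarith
      · linarith) (by
      obtain ⟨v, hv, hv0, hNv⟩ := hne
      refine ⟨v, hv, ?_⟩
      have hpos : 0 < v ⬝ᵥ v := lt_of_le_of_ne (hdot v)
        (fun h0 => hv0 (dotProduct_self_eq_zero.1 h0.symm))
      rw [hshift]
      positivity)
  refine ⟨α, ε, hα, hε, fun v hv => ?_⟩
  have := hle v hv
  rw [hshift, hshift] at this
  have h2 : 0 ≤ α * (ε / 2 * (v ⬝ᵥ v)) := mul_nonneg hα (mul_nonneg (by linarith) (hdot v))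
  linarith

end SLemma

/-! ### Auxiliary facts: growth, Cauchy–Schwarz, factorization -/

theorem nonneg_of_forall_quadratic_pos {a b c : ℝ}
    (h : ∀ s : ℝ, 0 ≤ s → 0 < a + 2 * s * b + s ^ 2 * c) : 0 ≤ c := by
  by_contra! hc
  set s := (|a| + 2 * |b|) / (-c) + 1 with hs
  have h0 : 0 ≤ (|a| + 2 * |b|) / (-c) := div_nonneg (by positivity) (by linarith)
  have hs1 : 1 ≤ s := by linarith
  have h1 : s * (-c) = |a| + 2 * |b| + -c := by
    rw [hs, add_mul, one_mul, div_mul_cancel₀ _ (by linarith)]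
  have h2 : s ^ 2 * c = -(s * (|a| + 2 * |b| + -c)) := by rw [← h1]; ring
  have h3 := h s (by linarith)
  rw [h2] at h3
  nlinarith [le_abs_self a, le_abs_self b, abs_nonneg a, abs_nonneg b,
    mul_nonneg (by linarith : 0 ≤ s) (sub_nonneg.2 (le_abs_self b)),
    mul_nonneg (by linarith : 0 ≤ s - 1) (abs_nonneg a)]

/-- A symmetric positive semidefinite form satisfies the Cauchy–Schwarz inequality. -/
theorem sq_dotProduct_mulVec_le {n : Type*} [Fintype n] {P : Matrix n n ℝ} (hP : P.IsSymm)
    (hnn : ∀ x : n → ℝ, 0 ≤ x ⬝ᵥ P *ᵥ x) (x y : n → ℝ) :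
    (x ⬝ᵥ P *ᵥ y) ^ 2 ≤ (x ⬝ᵥ P *ᵥ x) * (y ⬝ᵥ P *ᵥ y) := by
  have h : ∀ t : ℝ, 0 ≤ (y ⬝ᵥ P *ᵥ y) * (t * t) + (2 * (x ⬝ᵥ P *ᵥ y)) * t + x ⬝ᵥ P *ᵥ x := by
    intro t
    have := hnn (x + t • y)
    rw [dotProduct_mulVec_add_smul hP] at this
    linarith
  have := discrim_le_zero h
  unfold discrim at this
  linarith

/-- A linear map whose kernel contains that of `f` factors through `f`. -/
theorem exists_comp_eq_of_ker_le {K V W U : Type*} [Field K] [AddCommGroup V] [Module K V]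
    [AddCommGroup W] [Module K W] [AddCommGroup U] [Module K U] {f : V →ₗ[K] W} {g : V →ₗ[K] U}
    (h : LinearMap.ker f ≤ LinearMap.ker g) : ∃ k : W →ₗ[K] U, k ∘ₗ f = g := by
  obtain ⟨s, hs⟩ := f.rangeRestrict.exists_rightInverse_of_surjective f.range_rangeRestrict
  obtain ⟨s', hs'⟩ := s.exists_extend
  refine ⟨g ∘ₗ s', LinearMap.ext fun v => ?_⟩
  have h1 : s' (f v) = s (f.rangeRestrict v) := LinearMap.congr_fun hs' (f.rangeRestrict v)
  have h2 : f (s (f.rangeRestrict v)) = f v :=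
    congrArg Subtype.val (LinearMap.congr_fun hs (f.rangeRestrict v))
  have h3 : s' (f v) - v ∈ LinearMap.ker g := h (by simp [h1, h2])
  rw [LinearMap.mem_ker, map_sub, sub_eq_zero] at h3
  exact h3

/-! ### Block forms and their evaluation on `[I; Z]` -/

section Blocks

variable {q r : ℕ} {A : Matrix (Fin q ⊕ Fin r) (Fin q ⊕ Fin r) ℝ}

theorem sumElim_dotProduct_mulVec (A : Matrix (Fin q ⊕ Fin r) (Fin q ⊕ Fin r) ℝ)
    (x x' : Fin q → ℝ) (y y' : Fin r → ℝ) :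
    Sum.elim x y ⬝ᵥ A *ᵥ Sum.elim x' y' =
      x ⬝ᵥ A.toBlocks₁₁ *ᵥ x' + x ⬝ᵥ A.toBlocks₁₂ *ᵥ y' +
        (y ⬝ᵥ A.toBlocks₂₁ *ᵥ x' + y ⬝ᵥ A.toBlocks₂₂ *ᵥ y') := by
  conv_lhs => rw [← fromBlocks_toBlocks A, fromBlocks_mulVec]
  simp [sumElim_dotProduct_sumElim, dotProduct_add]

theorem sumElim_add_smul_dotProduct_mulVec (hA : A.IsSymm)
    (x : Fin q → ℝ) (y w : Fin r → ℝ) (t : ℝ) :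
    Sum.elim x (y + t • w) ⬝ᵥ A *ᵥ Sum.elim x (y + t • w) =
      Sum.elim x y ⬝ᵥ A *ᵥ Sum.elim x y +
        2 * t * (x ⬝ᵥ A.toBlocks₁₂ *ᵥ w + y ⬝ᵥ A.toBlocks₂₂ *ᵥ w) +
        t ^ 2 * (w ⬝ᵥ A.toBlocks₂₂ *ᵥ w) := by
  have h : Sum.elim x (y + t • w) = Sum.elim x y + t • Sum.elim (0 : Fin q → ℝ) w := by
    ext (i | i) <;> simp
  rw [h, dotProduct_mulVec_add_smul hA, sumElim_dotProduct_mulVec A x 0 y w,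
    sumElim_dotProduct_mulVec A 0 0 w w]
  simp

theorem mulVec_dotProduct_mulVec (Z : Matrix (Fin r) (Fin q) ℝ) (x : Fin q → ℝ) (v : Fin r → ℝ) :
    (Z *ᵥ x) ⬝ᵥ v = x ⬝ᵥ Zᵀ *ᵥ v := by
  rw [dotProduct_comm, dotProduct_mulVec, ← mulVec_transpose, dotProduct_comm]

theorem add_smul_vecMulVec_mulVec (Z : Matrix (Fin r) (Fin q) ℝ) (w : Fin r → ℝ)
    (z x : Fin q → ℝ) (s : ℝ) :
    (Z + s • vecMulVec w z) *ᵥ x = Z *ᵥ x + (s * (z ⬝ᵥ x)) • w := by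
  rw [add_mulVec, smul_mulVec, vecMulVec_mulVec]
  ext i
  simp
  ring

theorem toBlocks₂₂_isSymm (hA : A.IsSymm) : A.toBlocks₂₂.IsSymm := by
  ext i j
  exact hA.apply (Sum.inr i) (Sum.inr j)

theorem dotProduct_quadForm_mulVec (A : Matrix (Fin q ⊕ Fin r) (Fin q ⊕ Fin r) ℝ)
    (Z : Matrix (Fin r) (Fin q) ℝ) (x x' : Fin q → ℝ) :
    x ⬝ᵥ quadForm A Z *ᵥ x' = Sum.elim x (Z *ᵥ x) ⬝ᵥ A *ᵥ Sum.elim x' (Z *ᵥ x') := by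
  have h : ∀ x : Fin q → ℝ, fromRows (1 : Matrix (Fin q) (Fin q) ℝ) Z *ᵥ x =
      Sum.elim x (Z *ᵥ x) := fun x => by rw [fromRows_mulVec, one_mulVec]
  rw [quadForm, ← mulVec_mulVec, ← mulVec_mulVec, dotProduct_mulVec, vecMul_transpose, h, h]

theorem quadForm_isSymm (hA : A.IsSymm) (Z : Matrix (Fin r) (Fin q) ℝ) :
    (quadForm A Z).IsSymm := by
  simp only [quadForm, IsSymm, transpose_mul, transpose_transpose, hA.eq, Matrix.mul_assoc]

theorem isHermitian_of_isSymm {n : Type*} {B : Matrix n n ℝ} (hB : B.IsSymm) : B.IsHermitian := by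
  rw [IsHermitian, conjTranspose_eq_transpose_of_trivial, hB.eq]

theorem posSemidef_quadForm_iff (hA : A.IsSymm) {Z : Matrix (Fin r) (Fin q) ℝ} :
    (quadForm A Z).PosSemidef ↔
      ∀ x, 0 ≤ Sum.elim x (Z *ᵥ x) ⬝ᵥ A *ᵥ Sum.elim x (Z *ᵥ x) := by
  simp [posSemidef_iff_dotProduct_mulVec, quadForm_isSymm hA Z,
    dotProduct_quadForm_mulVec]

theorem posDef_quadForm_iff (hA : A.IsSymm) {Z : Matrix (Fin r) (Fin q) ℝ} :
    (quadForm A Z).PosDef ↔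
      ∀ x, x ≠ 0 → 0 < Sum.elim x (Z *ᵥ x) ⬝ᵥ A *ᵥ Sum.elim x (Z *ᵥ x) := by
  simp [posDef_iff_dotProduct_mulVec, quadForm_isSymm hA Z,
    dotProduct_quadForm_mulVec]

theorem posSemidef_sub_sub_iff {M N : Matrix (Fin q ⊕ Fin r) (Fin q ⊕ Fin r) ℝ}
    (hM : M.IsSymm) (hN : N.IsSymm) {α β : ℝ} :
    (M - α • N - fromBlocks (β • (1 : Matrix (Fin q) (Fin q) ℝ)) 0 0 0).PosSemidef ↔
      ∀ x y, β * (x ⬝ᵥ x) + α * (Sum.elim x y ⬝ᵥ N *ᵥ Sum.elim x y) ≤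
        Sum.elim x y ⬝ᵥ M *ᵥ Sum.elim x y := by
  have hs : (M - α • N -
      fromBlocks (β • (1 : Matrix (Fin q) (Fin q) ℝ)) 0 0 0).IsHermitian := by
    refine isHermitian_of_isSymm ((hM.sub (hN.smul α)).sub ?_)
    exact IsSymm.fromBlocks (isSymm_one.smul β) (by simp) isSymm_zero
  have key : ∀ x y, Sum.elim x y ⬝ᵥ (M - α • N -
      fromBlocks (β • (1 : Matrix (Fin q) (Fin q) ℝ)) 0 0 0) *ᵥ Sum.elim x y =
      Sum.elim x y ⬝ᵥ M *ᵥ Sum.elim x y - α * (Sum.elim x y ⬝ᵥ N *ᵥ Sum.elim x y) -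
        β * (x ⬝ᵥ x) := by
    intro x y
    simp [sub_mulVec, smul_mulVec, fromBlocks_mulVec, sumElim_dotProduct_sumElim]
  rw [posSemidef_iff_dotProduct_mulVec, and_iff_right hs]
  constructor
  · intro h x y
    have := h (Sum.elim x y)
    rw [star_trivial, key] at this
    linarith
  · intro h v
    have hv : v = Sum.elim (v ∘ Sum.inl) (v ∘ Sum.inr) := (Sum.elim_comp_inl_inr v).symm
    rw [star_trivial, hv, key]
    linarith [h (v ∘ Sum.inl) (v ∘ Sum.inr)]

theorem dotProduct_toBlocks₂₂_mulVec_nonpos (h : (-A.toBlocks₂₂).PosSemidef) (y : Fin r → ℝ) :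
    y ⬝ᵥ A.toBlocks₂₂ *ᵥ y ≤ 0 := by
  have := h.dotProduct_mulVec_nonneg y
  simp only [star_trivial, neg_mulVec, dotProduct_neg] at this
  linarith

theorem toBlocks₂₂_mulVec_eq_zero (h : (-A.toBlocks₂₂).PosSemidef) {y : Fin r → ℝ}
    (hy : 0 ≤ y ⬝ᵥ A.toBlocks₂₂ *ᵥ y) : A.toBlocks₂₂ *ᵥ y = 0 := by
  have h0 := le_antisymm (dotProduct_toBlocks₂₂_mulVec_nonpos h y) hy
  have := (h.dotProduct_mulVec_zero_iff y).1 (by simp [neg_mulVec, h0])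
  simpa [neg_mulVec] using this

end Blocks

/-! ### Perturbing solutions; from matrices to vectors -/

section Main

variable {q r : ℕ} {M N : Matrix (Fin q ⊕ Fin r) (Fin q ⊕ Fin r) ℝ}

/-- A direction in which the quadratic part of `N` is nonnegative yields an unbounded family of
solutions, so it lies in the kernel of `M₂₂`. -/
theorem toBlocks₂₂_mulVec_eq_zero_of_nonneg (hq : 0 < q) (hM : M.IsSymm) (hN : N.IsSymm)
    {Z₀ : Matrix (Fin r) (Fin q) ℝ} (hZ₀ : Z₀ ∈ solSet N)
    (hM22 : (-M.toBlocks₂₂).PosSemidef)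
    (H : ∀ Z, (quadForm N Z).PosSemidef → (quadForm M Z).PosDef)
    {w : Fin r → ℝ} (hw : 0 ≤ w ⬝ᵥ N.toBlocks₂₂ *ᵥ w) : M.toBlocks₂₂ *ᵥ w = 0 := by
  refine toBlocks₂₂_mulVec_eq_zero hM22 ?_
  have hZ₀' := (posSemidef_quadForm_iff hN).1 hZ₀
  set b : Fin q → ℝ := N.toBlocks₁₂ *ᵥ w + Z₀ᵀ *ᵥ (N.toBlocks₂₂ *ᵥ w) with hb
  have hbx : ∀ x, x ⬝ᵥ N.toBlocks₁₂ *ᵥ w + (Z₀ *ᵥ x) ⬝ᵥ N.toBlocks₂₂ *ᵥ w = x ⬝ᵥ b := by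
    intro x
    rw [mulVec_dotProduct_mulVec, hb, dotProduct_add]
  -- Taking `z = b` turns the cross term of `N` at `Z₀ + s w zᵀ` into a square; if `b = 0`, any
  -- nonzero `z` will do.
  obtain ⟨z, hz0, hz⟩ : ∃ z : Fin q → ℝ, z ≠ 0 ∧ ∀ x, 0 ≤ (z ⬝ᵥ x) * (x ⬝ᵥ b) := by
    by_cases hb0 : b = 0
    · exact ⟨fun _ => 1, fun h => one_ne_zero (congrFun h ⟨0, hq⟩), fun x => by simp [hb0]⟩
    · exact ⟨b, hb0, fun x => by rw [dotProduct_comm x b]; exact mul_self_nonneg _⟩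
  have hd : z ⬝ᵥ z ≠ 0 := fun h => hz0 (dotProduct_self_eq_zero.1 h)
  have key := nonneg_of_forall_quadratic_pos
    (a := Sum.elim z (Z₀ *ᵥ z) ⬝ᵥ M *ᵥ Sum.elim z (Z₀ *ᵥ z))
    (b := (z ⬝ᵥ z) * (z ⬝ᵥ M.toBlocks₁₂ *ᵥ w + (Z₀ *ᵥ z) ⬝ᵥ M.toBlocks₂₂ *ᵥ w))
    (c := (z ⬝ᵥ z) ^ 2 * (w ⬝ᵥ M.toBlocks₂₂ *ᵥ w)) (by
      intro s hs
      have h1 := (posDef_quadForm_iff hM).1 (H (Z₀ + s • vecMulVec w z) ((posSemidef_quadForm_iff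
        hN).2 (by
          intro x
          rw [add_smul_vecMulVec_mulVec, sumElim_add_smul_dotProduct_mulVec hN, hbx]
          have e1 : 0 ≤ s * ((z ⬝ᵥ x) * (x ⬝ᵥ b)) := mul_nonneg hs (hz x)
          have e2 := mul_nonneg (sq_nonneg (s * (z ⬝ᵥ x))) hw
          linarith [hZ₀' x]))) z hz0
      rw [add_smul_vecMulVec_mulVec, sumElim_add_smul_dotProduct_mulVec hM] at h1
      linarith)
  exact nonneg_of_mul_nonneg_right key (by positivity)

/-- If some direction in the kernel of `N₂₂` is not in the kernel of `N₁₂`, then the solution set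
is unbounded in every direction, so `M₂₂` vanishes. -/
theorem toBlocks₂₂_mulVec_eq_zero_of_mem_ker (hM : M.IsSymm) (hN : N.IsSymm)
    {Z₀ : Matrix (Fin r) (Fin q) ℝ} (hZ₀ : Z₀ ∈ solSet N)
    (hM22 : (-M.toBlocks₂₂).PosSemidef)
    (H : ∀ Z, (quadForm N Z).PosSemidef → (quadForm M Z).PosDef)
    {w : Fin r → ℝ} (hw : N.toBlocks₂₂ *ᵥ w = 0) (hw12 : N.toBlocks₁₂ *ᵥ w ≠ 0)
    (hMw : M.toBlocks₂₂ *ᵥ w = 0) (hMw12 : M.toBlocks₁₂ *ᵥ w = 0) (u : Fin r → ℝ) :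
    M.toBlocks₂₂ *ᵥ u = 0 := by
  refine toBlocks₂₂_mulVec_eq_zero hM22 ?_
  have hZ₀' := (posSemidef_quadForm_iff hN).1 hZ₀
  set a : Fin q → ℝ := N.toBlocks₁₂ *ᵥ w with ha
  set g : Fin q → ℝ := N.toBlocks₁₂ *ᵥ u + Z₀ᵀ *ᵥ (N.toBlocks₂₂ *ᵥ u) with hg
  have hgx : ∀ x, x ⬝ᵥ N.toBlocks₁₂ *ᵥ u + (Z₀ *ᵥ x) ⬝ᵥ N.toBlocks₂₂ *ᵥ u = x ⬝ᵥ g := by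
    intro x
    rw [mulVec_dotProduct_mulVec, hg, dotProduct_add]
  have hd : a ⬝ᵥ a ≠ 0 := fun h => hw12 (dotProduct_self_eq_zero.1 h)
  have key := nonneg_of_forall_quadratic_pos
    (a := Sum.elim a (Z₀ *ᵥ a) ⬝ᵥ M *ᵥ Sum.elim a (Z₀ *ᵥ a))
    (b := (a ⬝ᵥ a) * (a ⬝ᵥ M.toBlocks₁₂ *ᵥ u + (Z₀ *ᵥ a) ⬝ᵥ M.toBlocks₂₂ *ᵥ u))
    (c := (a ⬝ᵥ a) ^ 2 * (u ⬝ᵥ M.toBlocks₂₂ *ᵥ u)) (by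
      intro t _
      set c := u ⬝ᵥ N.toBlocks₂₂ *ᵥ u
      have h1 := (posDef_quadForm_iff hM).1
        -- As `N₂₂ w = 0`, the `w`-correction enters `N` linearly: `-t g` cancels the cross term,
        -- and `t² |c| a` outweighs the term `t² c (a ⬝ᵥ x)²`.
        (H (Z₀ + t • vecMulVec u a + (1 : ℝ) • vecMulVec w ((t ^ 2 * |c|) • a - t • g))
        ((posSemidef_quadForm_iff hN).2 (by
          intro x
          rw [add_smul_vecMulVec_mulVec, sumElim_add_smul_dotProduct_mulVec hN,
            add_smul_vecMulVec_mulVec, sumElim_add_smul_dotProduct_mulVec hN, hgx, hw, ← ha]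
          simp only [dotProduct_zero, sub_dotProduct, smul_dotProduct, smul_eq_mul,
            dotProduct_comm x]
          have e1 := hZ₀' x
          have e2 : 0 ≤ (t * (a ⬝ᵥ x)) ^ 2 * (2 * |c| + c) :=
            mul_nonneg (sq_nonneg _) (by linarith [neg_abs_le c, abs_nonneg c])
          nlinarith))) a hw12
      rw [add_smul_vecMulVec_mulVec, sumElim_add_smul_dotProduct_mulVec hM,
        add_smul_vecMulVec_mulVec, sumElim_add_smul_dotProduct_mulVec hM, hMw, hMw12] at h1
      simp only [dotProduct_zero] at h1
      linarith)
  exact nonneg_of_mul_nonneg_right key (by positivity)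

/-- Here `M` depends on `x` alone, so definiteness at one `Z₀` is definiteness in `x`. The strict
S-lemma with `N = 0` on the subspace `y = 0` only supplies `β`. -/
theorem exists_of_toBlocks_eq_zero (hq : 0 < q) (hM : M.IsSymm) (hN : N.IsSymm)
    {Z₀ : Matrix (Fin r) (Fin q) ℝ} (hZ₀ : (quadForm M Z₀).PosDef)
    (h22 : ∀ y, M.toBlocks₂₂ *ᵥ y = 0) (h12 : ∀ y, M.toBlocks₁₂ *ᵥ y = 0) :
    ∃ α β : ℝ, 0 ≤ α ∧ 0 < β ∧
      (M - α • N - fromBlocks (β • (1 : Matrix (Fin q) (Fin q) ℝ)) 0 0 0).PosSemidef := by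
  have hZ := (posDef_quadForm_iff hM).1 hZ₀
  have hy : ∀ x y y', Sum.elim x y ⬝ᵥ M *ᵥ Sum.elim x y =
      Sum.elim x y' ⬝ᵥ M *ᵥ Sum.elim x y' := by
    intro x y y'
    have := sumElim_add_smul_dotProduct_mulVec hM x y' (y - y') 1
    simpa [h22, h12] using this
  obtain ⟨α, β, -, hβ, h⟩ := exists_add_mul_le_of_nonneg_imp_pos
    (S := LinearMap.ker (LinearMap.funLeft ℝ ℝ (Sum.inr : Fin r → Fin q ⊕ Fin r)))
    (N := 0) hM isSymm_zero (by
      intro v hv hv0 _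
      have hv' : v = Sum.elim (v ∘ Sum.inl) (v ∘ Sum.inr) := (Sum.elim_comp_inl_inr v).symm
      have hvr : v ∘ Sum.inr = 0 := hv
      rw [hv', hy _ _ (Z₀ *ᵥ (v ∘ Sum.inl))]
      refine hZ _ fun h0 => hv0 ?_
      rw [hv', h0, hvr]
      ext (i | i) <;> rfl)
    ⟨Sum.elim (fun _ => 1) 0, rfl, fun h => one_ne_zero (congrFun h (Sum.inl ⟨0, hq⟩)), by simp⟩
  refine ⟨0, β, le_rfl, hβ, (posSemidef_sub_sub_iff hM hN).2 fun x y => ?_⟩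
  have := h (Sum.elim x 0) rfl
  rw [sumElim_dotProduct_sumElim, hy x 0 y] at this
  simpa using this

/-- If the quadratic matrix function of `N` is concave and attains its maximum, then each vector
on which `N` is nonnegative lies, modulo `ker N₂₂`, in the range of `[I; Z]` for a solution `Z`. -/
theorem pos_of_nonneg (hM : M.IsSymm) (hN : N.IsSymm)
    {Z₀ Zc : Matrix (Fin r) (Fin q) ℝ} (hZ₀ : Z₀ ∈ solSet N)
    (hN22 : (-N.toBlocks₂₂).PosSemidef)
    (hN12 : ∀ x e, x ⬝ᵥ N.toBlocks₁₂ *ᵥ e + (Zc *ᵥ x) ⬝ᵥ N.toBlocks₂₂ *ᵥ e = 0)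
    (hker22 : ∀ w, N.toBlocks₂₂ *ᵥ w = 0 → M.toBlocks₂₂ *ᵥ w = 0)
    (hker12 : ∀ w, M.toBlocks₂₂ *ᵥ w = 0 → M.toBlocks₁₂ *ᵥ w = 0)
    (H : ∀ Z, (quadForm N Z).PosSemidef → (quadForm M Z).PosDef)
    {x : Fin q → ℝ} {y : Fin r → ℝ} (hx : x ≠ 0)
    (hxy : 0 ≤ Sum.elim x y ⬝ᵥ N *ᵥ Sum.elim x y) :
    0 < Sum.elim x y ⬝ᵥ M *ᵥ Sum.elim x y := by
  have hexp : ∀ (x : Fin q → ℝ) (e : Fin r → ℝ) (t : ℝ),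
      Sum.elim x (Zc *ᵥ x + t • e) ⬝ᵥ N *ᵥ Sum.elim x (Zc *ᵥ x + t • e) =
        x ⬝ᵥ quadForm N Zc *ᵥ x + t ^ 2 * (e ⬝ᵥ N.toBlocks₂₂ *ᵥ e) := by
    intro x e t
    rw [sumElim_add_smul_dotProduct_mulVec hN, hN12, dotProduct_quadForm_mulVec]
    ring
  have hneg := dotProduct_toBlocks₂₂_mulVec_nonpos hN22
  -- The value at `Zc` dominates the value at the solution `Z₀`.
  have hP : ∀ x : Fin q → ℝ, 0 ≤ x ⬝ᵥ quadForm N Zc *ᵥ x := by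
    intro x
    have h1 := (posSemidef_quadForm_iff hN).1 hZ₀ x
    have h2 : Z₀ *ᵥ x = Zc *ᵥ x + (1 : ℝ) • (Z₀ *ᵥ x - Zc *ᵥ x) := by simp
    rw [h2, hexp] at h1
    linarith [hneg (Z₀ *ᵥ x - Zc *ᵥ x)]
  have hPs := quadForm_isSymm hN Zc
  obtain ⟨e, rfl⟩ : ∃ e, y = Zc *ᵥ x + (1 : ℝ) • e := ⟨y - Zc *ᵥ x, by simp⟩
  rw [hexp] at hxy
  rcases (hP x).eq_or_lt with hd | hd
  · have he := toBlocks₂₂_mulVec_eq_zero hN22 (y := e) (by linarith)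
    have hZc : (quadForm N Zc).PosSemidef :=
      (posSemidef_quadForm_iff hN).2 fun x => by
        rw [← dotProduct_quadForm_mulVec]; exact hP x
    rw [sumElim_add_smul_dotProduct_mulVec hM, hker12 e (hker22 e he), hker22 e he]
    simpa using (posDef_quadForm_iff hM).1 (H Zc hZc) x hx
  · set d := x ⬝ᵥ quadForm N Zc *ᵥ x with hd_def
    have h1 := (posDef_quadForm_iff hM).1
      -- With `P = quadForm N Zc`, this matrix sends `x` to `Zc x + e`; the square it subtracts at
      -- `x'` is at most `(x'ᵀ P x)² / d ≤ x'ᵀ P x'`.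
      (H (Zc + d⁻¹ • vecMulVec e (quadForm N Zc *ᵥ x)) ((posSemidef_quadForm_iff hN).2 (by
        intro x'
        rw [add_smul_vecMulVec_mulVec, hexp, dotProduct_comm _ x']
        have hcs := sq_dotProduct_mulVec_le hPs hP x' x
        rw [← hd_def] at hcs
        have e1 : (d⁻¹ * (x' ⬝ᵥ quadForm N Zc *ᵥ x)) ^ 2 * d ≤ x' ⬝ᵥ quadForm N Zc *ᵥ x' := by
          rw [mul_pow, inv_pow, mul_assoc, inv_mul_le_iff₀ (by positivity)]
          nlinarith
        have e2 := mul_nonneg (sq_nonneg (d⁻¹ * (x' ⬝ᵥ quadForm N Zc *ᵥ x))) hxy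
        linarith))) x hx
    rw [add_smul_vecMulVec_mulVec, dotProduct_comm _ x, ← hd_def, inv_mul_cancel₀ hd.ne'] at h1
    exact h1

theorem exists_of_ker_le (hq : 0 < q) (hM : M.IsSymm) (hN : N.IsSymm)
    {Z₀ : Matrix (Fin r) (Fin q) ℝ} (hZ₀ : Z₀ ∈ solSet N)
    (hN22 : (-N.toBlocks₂₂).PosSemidef)
    (hN12 : ∀ w, N.toBlocks₂₂ *ᵥ w = 0 → N.toBlocks₁₂ *ᵥ w = 0)
    (hker22 : ∀ w, N.toBlocks₂₂ *ᵥ w = 0 → M.toBlocks₂₂ *ᵥ w = 0)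
    (hker12 : ∀ w, M.toBlocks₂₂ *ᵥ w = 0 → M.toBlocks₁₂ *ᵥ w = 0)
    (H : ∀ Z, (quadForm N Z).PosSemidef → (quadForm M Z).PosDef) :
    ∃ α β : ℝ, 0 ≤ α ∧ 0 < β ∧
      (M - α • N - fromBlocks (β • (1 : Matrix (Fin q) (Fin q) ℝ)) 0 0 0).PosSemidef := by
  obtain ⟨k, hk⟩ := exists_comp_eq_of_ker_le
    (f := N.toBlocks₂₂.mulVecLin) (g := N.toBlocks₁₂.mulVecLin) fun w hw => hN12 w hw
  have hk' : ∀ w, LinearMap.toMatrix' k *ᵥ (N.toBlocks₂₂ *ᵥ w) = N.toBlocks₁₂ *ᵥ w := fun w => by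
    rw [LinearMap.toMatrix'_mulVec]
    exact LinearMap.congr_fun hk w
  have hpos := fun (x : Fin q → ℝ) (y : Fin r → ℝ) =>
    -- From `N₁₂ = k N₂₂`, the choice `Zc = -kᵀ` removes the cross terms.
    pos_of_nonneg (x := x) (y := y) (Zc := -(LinearMap.toMatrix' k)ᵀ) hM hN hZ₀ hN22 (by
      intro x e
      rw [mulVec_dotProduct_mulVec, transpose_neg, transpose_transpose, neg_mulVec, hk']
      simp) hker22 hker12 H
  obtain ⟨C, hC⟩ := (LinearMap.ker N.toBlocks₂₂.mulVecLin).exists_isCompl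
  have hsplit : ∀ y : Fin r → ℝ, ∃ c ∈ C, ∃ w, N.toBlocks₂₂ *ᵥ w = 0 ∧ y = c + (1 : ℝ) • w := by
    intro y
    obtain ⟨w, hw, c, hc, rfl⟩ := Submodule.mem_sup.1
      (hC.sup_eq_top ▸ Submodule.mem_top : y ∈ LinearMap.ker N.toBlocks₂₂.mulVecLin ⊔ C)
    exact ⟨c, hc, w, hw, by rw [one_smul, add_comm]⟩
  have hshift : ∀ (B : Matrix (Fin q ⊕ Fin r) (Fin q ⊕ Fin r) ℝ) (x : Fin q → ℝ)
      (c w : Fin r → ℝ), B.IsSymm → B.toBlocks₂₂ *ᵥ w = 0 → B.toBlocks₁₂ *ᵥ w = 0 →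
      Sum.elim x (c + (1 : ℝ) • w) ⬝ᵥ B *ᵥ Sum.elim x (c + (1 : ℝ) • w) =
        Sum.elim x c ⬝ᵥ B *ᵥ Sum.elim x c := by
    intro B x c w hB h1 h2
    rw [sumElim_add_smul_dotProduct_mulVec hB, h1, h2]
    simp
  obtain ⟨α, β, hα, hβ, h⟩ := exists_add_mul_le_of_nonneg_imp_pos
    -- Both forms vanish on `(0, w)` for `w ∈ ker N₂₂`, so strictness requires `y` to stay in the
    -- complement `C`.
    (S := C.comap (LinearMap.funLeft ℝ ℝ (Sum.inr : Fin r → Fin q ⊕ Fin r))) hM hN (by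
      intro v hv hv0 hNv
      have hv' : v = Sum.elim (v ∘ Sum.inl) (v ∘ Sum.inr) := (Sum.elim_comp_inl_inr v).symm
      have hvC : v ∘ Sum.inr ∈ C := hv
      generalize v ∘ Sum.inl = x at hv'
      generalize v ∘ Sum.inr = y at hv' hvC
      subst hv'
      by_cases hx : x = 0
      · subst hx
        rw [sumElim_dotProduct_mulVec] at hNv
        have hy := toBlocks₂₂_mulVec_eq_zero hN22 (y := y) (by simpa using hNv)
        have hy0 : y = 0 := Submodule.disjoint_def.1 hC.disjoint y hy hvC
        refine absurd ?_ hv0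
        rw [hy0]
        ext (i | i) <;> rfl
      · exact hpos x y hx hNv) (by
      obtain ⟨c, hc, w, hw, hcw⟩ := hsplit (Z₀ *ᵥ fun _ => 1)
      refine ⟨Sum.elim (fun _ => 1) c, hc,
        fun h => one_ne_zero (congrFun h (Sum.inl ⟨0, hq⟩)), ?_⟩
      have := (posSemidef_quadForm_iff hN).1 hZ₀ fun _ => 1
      rwa [hcw, hshift N _ _ _ hN hw (hN12 w hw)] at this)
  refine ⟨α, β, hα, hβ, (posSemidef_sub_sub_iff hM hN).2 fun x y => ?_⟩
  obtain ⟨c, hc, w, hw, rfl⟩ := hsplit y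
  rw [hshift N _ _ _ hN hw (hN12 w hw), hshift M _ _ _ hM (hker22 w hw) (hker12 w (hker22 w hw))]
  have h1 := h (Sum.elim x c) hc
  rw [sumElim_dotProduct_sumElim] at h1
  have h2 : 0 ≤ β * (c ⬝ᵥ c) :=
    mul_nonneg hβ.le (Finset.sum_nonneg fun i _ => mul_self_nonneg (c i))
  linarith

end Main

end QMI

/-! ### The equivalence -/

theorem theorem2 {q r : ℕ} (hq : 0 < q)
    (M N : Matrix (Fin q ⊕ Fin r) (Fin q ⊕ Fin r) ℝ)
    (hM : M.IsSymm) (hN : N.IsSymm)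
    (hne : (QMI.solSet N).Nonempty)
    (hM22 : (-M.toBlocks₂₂).PosSemidef)
    (hker : LinearMap.ker M.toBlocks₂₂.mulVecLin ≤ LinearMap.ker M.toBlocks₁₂.mulVecLin) :
    (∀ Z : Matrix (Fin r) (Fin q) ℝ,
        (QMI.quadForm N Z).PosSemidef → (QMI.quadForm M Z).PosDef) ↔
      ∃ α β : ℝ, 0 ≤ α ∧ 0 < β ∧
        (M - α • N -
          Matrix.fromBlocks (β • (1 : Matrix (Fin q) (Fin q) ℝ)) 0 0 0).PosSemidef := by
  open Matrix QMI in
  obtain ⟨Z₀, hZ₀⟩ := hne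
  have hker12 : ∀ w, M.toBlocks₂₂ *ᵥ w = 0 → M.toBlocks₁₂ *ᵥ w = 0 := fun w hw => hker hw
  constructor
  · intro H
    have hA := fun w => toBlocks₂₂_mulVec_eq_zero_of_nonneg (w := w) hq hM hN hZ₀ hM22 H
    have hzero (h : ∀ y, M.toBlocks₂₂ *ᵥ y = 0) :=
      exists_of_toBlocks_eq_zero hq hM hN (H Z₀ hZ₀) h fun y => hker12 y (h y)
    by_cases hpos : ∃ w, 0 < w ⬝ᵥ N.toBlocks₂₂ *ᵥ w
    · obtain ⟨w, hw⟩ := hpos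
      refine hzero fun u => ?_
      -- Positivity is an open condition, so `M₂₂` kills both `w` and `w + t u` for some `t > 0`,
      -- hence `u`.
      have hcont : Continuous fun t : ℝ => (w + t • u) ⬝ᵥ N.toBlocks₂₂ *ᵥ (w + t • u) := by
        simp only [dotProduct_mulVec_add_smul (toBlocks₂₂_isSymm hN)]
        fun_prop
      have hev : ∀ᶠ t : ℝ in nhds 0, 0 < (w + t • u) ⬝ᵥ N.toBlocks₂₂ *ᵥ (w + t • u) :=
        hcont.continuousAt.eventually (lt_mem_nhds (by simpa using hw))
      obtain ⟨ε, hε, hball⟩ := Metric.eventually_nhds_iff.1 hev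
      have h1 := hA _ (hball (y := ε / 2) (by
        rw [Real.dist_eq, sub_zero, abs_of_pos (half_pos hε)]; linarith)).le
      rw [mulVec_add, mulVec_smul, hA w hw.le, zero_add] at h1
      exact (smul_eq_zero.1 h1).resolve_left (half_pos hε).ne'
    push Not at hpos
    have hker22 : ∀ w, N.toBlocks₂₂ *ᵥ w = 0 → M.toBlocks₂₂ *ᵥ w = 0 :=
      fun w hw => hA w (by simp [hw])
    by_cases hN12 : ∀ w, N.toBlocks₂₂ *ᵥ w = 0 → N.toBlocks₁₂ *ᵥ w = 0
    · refine exists_of_ker_le hq hM hN hZ₀ ?_ hN12 hker22 hker12 H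
      refine .of_dotProduct_mulVec_nonneg (isHermitian_of_isSymm (toBlocks₂₂_isSymm hN).neg) ?_
      intro x
      simpa [neg_mulVec] using hpos x
    · push Not at hN12
      obtain ⟨w, hw, hw12⟩ := hN12
      exact hzero (toBlocks₂₂_mulVec_eq_zero_of_mem_ker hM hN hZ₀ hM22 H hw hw12
        (hker22 w hw) (hker12 w (hker22 w hw)))
  · rintro ⟨α, β, hα, hβ, h⟩ Z hZ
    rw [posSemidef_sub_sub_iff hM hN] at h
    rw [posSemidef_quadForm_iff hN] at hZ
    refine (posDef_quadForm_iff hM).2 fun x hx => ?_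
    have hpos : 0 < x ⬝ᵥ x := lt_of_le_of_ne
      (Finset.sum_nonneg fun i _ => mul_self_nonneg (x i))
      (fun h0 => hx (dotProduct_self_eq_zero.1 h0.symm))
    have h1 := h x (Z *ᵥ x)
    have h2 := mul_nonneg hα (hZ x)
    have h3 := mul_pos hβ hpos
    linarith
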